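/- Let $(\Bbbk,\tau)$ be a field with a (Hausdorff) ring topology, i.e. a Hausdorff topology on $\Bbbk$ for which addition, negation and multiplication are continuous. *Topologically free spaces.* Let $\mathbf{TopFreeVect}_{(\Bbbk,\tau)}$ be the category whose objects are the topological $(\Bbbk,\tau)$-vector spaces isomorphic (linearly and homeomorphically) to $\Bbbk^X$ with the product topology, for some set $X$, and whose morphisms are the continuous linear maps. For a vector space $V$ let $V^*$ be its algebraic dual with the weak-$*$ topology (the topology of pointwise convergence on $V$, $\Bbbk$ carrying $\tau$); for a topological vector space $M$ let $M'$ be the vector space of continuous linear forms on $M$. The category $\mathbf{TopFreeVect}_{(\Bbbk,\tau)}$ is monoidal for $M\circledast N := (M'\otimes_{\Bbbk} N')^*$, on maps $f\circledast g:=(f'\otimes g')^*$ with $f'$, $g'$ the transposes, with unit $(\Bbbk,\tau)$. For $u\in M$, $v\in N$ let $u\circledast v\in M\circledast N$ be given by $(u\circledast v)(\ell_1\otimes\ell_2)=\ell_1(u)\,\ell_2(v)$; the associativity and unit constraints are the isomorphisms of topological vector spaces determined by $(u\circledast v)\circledast w\mapsto u\circledast(v\circledast w)$, $c\circledast u\mapsto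 cu$ and $u\circledast c\mapsto cu$. *Underlying algebra.* Let $\mathbf{Vect}_\Bbbk$ be the monoidal category of vector spaces with $\otimes_\Bbbk$, let ${}_1\mathbf{Alg}_\Bbbk$ be the category of associative unital $\Bbbk$-algebras, and let $O:\mathbf{Mon}(\mathbf{Vect}_\Bbbk)\to{}_1\mathbf{Alg}_\Bbbk$ be the standard equivalence, with inverse $O^{-1}$. Let $\widetilde{\mathbb A}:\mathbf{Mon}(\mathbf{TopFreeVect}_{(\Bbbk,\tau)})\to\mathbf{Mon}(\mathbf{Vect}_\Bbbk)$ be induced by the forgetful functor, lax monoidal through $u\otimes v\mapsto u\circledast v$ and $\mathrm{id}_\Bbbk$. Thus $O(\widetilde{\mathbb A}(M,\mu,\eta))$ is the vector space $M$ with product $uv=\mu(u\circledast v)$ and unit $\eta(1)$. *Finite dual.* Let $D_{fin}:\mathbf{Mon}(\mathbf{Vect}_\Bbbk)^{\mathsf{op}}\to\mathbf{Coalg}_\Bbbk$ (counital coassociative coalgebras) send a monoid with associated algebra $A$ to the coalgebra $A^0$ of all linear forms on $A$ that vanish on some two-sided ideal of finite codimension, with $\Delta(f)=\sum_i f_i\otimes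 g_i$ if and only if $f(ab)=\sum_i f_i(a)g_i(b)$ for all $a,b\in A$, and $\epsilon(f)=f(1_A)$; on morphisms it is precomposition. *Algebraic dual monoid.* Let $\widetilde{\mathbb{Alg}_{(\Bbbk,\tau)}}:\mathbf{Coalg}_\Bbbk^{\mathsf{op}}\to\mathbf{Mon}(\mathbf{TopFreeVect}_{(\Bbbk,\tau)})$ send $(C,\Delta,\epsilon)$ to $C^*$ with the weak-$*$ topology, multiplication determined by $f\circledast g\mapsto (f\otimes g)\circ\Delta$ (where $f\otimes g$ is read as a linear form on $C\otimes C$), and unit $c\mapsto c\,\epsilon$; on morphisms it is transposition. (It is induced by the functor $V\mapsto V^*$ with the coherence maps $V^*\circledast W^*\to(V\otimes W)^*$ dual to $\Lambda_V\otimes\Lambda_W$, where $\Lambda_V(v)=(f\mapsto f(v))$, and $\Bbbk\to\Bbbk^*$, $1\mapsto\mathrm{id}$.) **Proposition.** The functor $$O\circ\widetilde{\mathbb A}:\mathbf{Mon}(\mathbf{TopFreeVect}_{(\Bbbk,\tau)})\longrightarrow{}_1\mathbf{Alg}_\Bbbk$$ has a left adjoint, namely $\widetilde{\mathbb{Alg}_{(\Bbbk,\tau)}}\circ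 D_{fin}^{\mathsf{op}}\circ O^{-1}$. -/

import Mathlib

open CategoryTheory MonoidalCategory Opposite
open scoped TensorProduct

universe u

set_option linter.unusedSectionVars false
set_option linter.unusedVariables false

noncomputable section

namespace TopFree

section FiniteDual

variable {k : Type*} [Field k]

/-- If the functionals `v i` separate the points of `M` and the functionals `w j` separate the
points of `N`, then the functionals `v i ⊗ w j` separate the points of `M ⊗ N`. -/
theorem eq_zero_of_dualDistrib {M N ι κ : Type*} [AddCommGroup M] [Module k M]
    [AddCommGroup N] [Module k N] (v : ι → Module.Dual k M) (w : κ → Module.Dual k N)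
    (hv : ∀ m, (∀ i, v i m = 0) → m = 0) (hw : ∀ n, (∀ j, w j n = 0) → n = 0)
    (t : M ⊗[k] N)
    (h : ∀ i j, TensorProduct.dualDistrib k M N (v i ⊗ₜ w j) t = 0) : t = 0 := by
  classical
  let b := Module.Basis.ofVectorSpace k N
  let e := TensorProduct.equivFinsuppOfBasisRight (M := M) b
  apply e.injective
  rw [map_zero]
  ext x
  rw [Finsupp.zero_apply]
  apply hv
  intro i
  let c : M ⊗[k] N →ₗ[k] N := (TensorProduct.lid k N).toLinearMap ∘ₗ (v i).rTensor N
  have hc : c t = 0 := by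
    apply hw
    intro j
    rw [← h i j]
    have : w j ∘ₗ c = TensorProduct.dualDistrib k M N (v i ⊗ₜ w j) := by
      apply TensorProduct.ext'
      intro m n
      simp [c]
    exact LinearMap.congr_fun this t
  have h2 : b.coord x ∘ₗ c = v i ∘ₗ Finsupp.lapply x ∘ₗ e.toLinearMap := by
    apply TensorProduct.ext'
    intro m n
    simp [c, e, mul_comm]
  have h3 := LinearMap.congr_fun h2 t
  simp only [LinearMap.comp_apply, hc, map_zero] at h3
  exact h3.symm

variable (k) (A : Type*) [Ring A] [Algebra k A]

/-- The underlying space `A⁰` of the finite dual: the linear forms on `A` whose kernel contains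
a two-sided ideal of finite codimension. -/
def finiteDualSubmodule : Submodule k (Module.Dual k A) where
  carrier := {f | ∃ I : Ideal A, I.IsTwoSided ∧ Module.Finite k (A ⧸ I) ∧ ∀ a ∈ I, f a = 0}
  zero_mem' := ⟨⊤, inferInstance, inferInstance, fun _ _ => rfl⟩
  add_mem' := by
    rintro f g ⟨I, hI, hI', hf⟩ ⟨J, hJ, hJ', hg⟩
    refine ⟨I ⊓ J, ⟨fun b ha => ⟨I.mul_mem_right b ha.1, J.mul_mem_right b ha.2⟩⟩, ?_,
      fun a ha => ?_⟩
    · let p : A →ₗ[k] (A ⧸ I) × (A ⧸ J) :=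
        ((I.mkQ).restrictScalars k).prod ((J.mkQ).restrictScalars k)
      have hp : LinearMap.ker p = (I ⊓ J).restrictScalars k := by
        ext x; simp [p]
      let q := (LinearMap.ker p).liftQ p le_rfl
      have hq : Function.Injective q := by
        rw [← LinearMap.ker_eq_bot]; exact Submodule.ker_liftQ_eq_bot _ _ _ le_rfl
      have := Module.Finite.of_injective q hq
      rw [hp] at this
      exact this
    · rw [LinearMap.add_apply, hf a ha.1, hg a ha.2, add_zero]
  smul_mem' := by
    rintro c f ⟨I, hI, hI', hf⟩
    exact ⟨I, hI, hI', fun a ha => by rw [LinearMap.smul_apply, hf a ha, smul_zero]⟩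

/-- The finite dual `A⁰` as a vector space. -/
def FiniteDual : Type _ := ↥(finiteDualSubmodule k A)

namespace FiniteDual

instance : AddCommGroup (FiniteDual k A) := inferInstanceAs (AddCommGroup (finiteDualSubmodule k A))

instance : Module k (FiniteDual k A) := inferInstanceAs (Module k (finiteDualSubmodule k A))

/-- The inclusion of `A⁰` in the algebraic dual of `A`. -/
def incl : FiniteDual k A →ₗ[k] Module.Dual k A := (finiteDualSubmodule k A).subtype

/-- The canonical map `A⁰ ⊗ A⁰ → (A ⊗ A)^*`, `(f ⊗ g)(a ⊗ b) = f(a) g(b)`. -/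
def pairing : FiniteDual k A ⊗[k] FiniteDual k A →ₗ[k] Module.Dual k (A ⊗[k] A) :=
  TensorProduct.dualDistrib k A A ∘ₗ
    TensorProduct.map (incl k A) (incl k A)

@[simp]
theorem pairing_tmul (f g : FiniteDual k A) (a b : A) :
    pairing k A (f ⊗ₜ g) (a ⊗ₜ b) = f.1 a * g.1 b := rfl

/-- Evaluation at `a`, as a linear form on `A⁰`. -/
def ev (a : A) : Module.Dual k (FiniteDual k A) :=
  LinearMap.applyₗ a ∘ₗ incl k A

@[simp]
theorem ev_apply (a : A) (f : FiniteDual k A) : ev k A a f = f.1 a := rfl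

theorem ev_sep (f : FiniteDual k A) (h : ∀ a, ev k A a f = 0) : f = 0 :=
  Subtype.ext (LinearMap.ext h)

theorem pairing_apply_tmul (t : FiniteDual k A ⊗[k] FiniteDual k A) (a b : A) :
    pairing k A t (a ⊗ₜ b) = TensorProduct.dualDistrib k _ _ (ev k A a ⊗ₜ ev k A b) t := by
  induction t with
  | zero => simp
  | tmul f g => simp
  | add x y hx hy => simp [hx, hy]

theorem pairing_injective : Function.Injective (pairing k A) := by
  rw [injective_iff_map_eq_zero]
  intro t ht
  refine eq_zero_of_dualDistrib (ev k A) (ev k A) (ev_sep k A) (ev_sep k A) t fun a b => ?_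
  rw [← pairing_apply_tmul, ht, LinearMap.zero_apply]

variable {k A} in
theorem comp_mul_mem_range (f : FiniteDual k A) :
    f.1 ∘ₗ LinearMap.mul' k A ∈ LinearMap.range (pairing k A) := by
  obtain ⟨f, I, hI, hfin, hf⟩ := f
  let π : A →ₐ[k] A ⧸ I := Ideal.Quotient.mkₐ k I
  let fb : Module.Dual k (A ⧸ I) :=
    (I.restrictScalars k).liftQ f (fun a ha => hf a ha)
  have hfb : ∀ a, fb (π a) = f a := fun a => rfl
  let r : Module.Dual k (A ⧸ I) →ₗ[k] FiniteDual k A :=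
    LinearMap.codRestrict (finiteDualSubmodule k A) (Module.Dual.transpose (R := k) π.toLinearMap) fun g =>
      ⟨I, hI, hfin, fun a ha => by
        change g (Ideal.Quotient.mk I a) = 0
        rw [Ideal.Quotient.eq_zero_iff_mem.mpr ha, map_zero]⟩
  let t := (TensorProduct.dualDistribEquiv k (A ⧸ I) (A ⧸ I)).symm
    (fb ∘ₗ LinearMap.mul' k (A ⧸ I))
  have ht : TensorProduct.dualDistrib k _ _ t = fb ∘ₗ LinearMap.mul' k (A ⧸ I) :=
    (TensorProduct.dualDistribEquiv k (A ⧸ I) (A ⧸ I)).apply_symm_apply _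
  refine ⟨TensorProduct.map r r t, TensorProduct.ext' fun a b => ?_⟩
  have key : ∀ s : Module.Dual k (A ⧸ I) ⊗[k] Module.Dual k (A ⧸ I),
      pairing k A (TensorProduct.map r r s) (a ⊗ₜ b) =
        TensorProduct.dualDistrib k _ _ s (π a ⊗ₜ π b) := by
    intro s
    induction s with
    | zero => simp
    | tmul f g => rfl
    | add x y hx hy => simp only [map_add, LinearMap.add_apply, hx, hy]
  rw [key, ht]
  simp only [LinearMap.comp_apply, LinearMap.mul'_apply]
  rw [← map_mul, hfb]

/-- The comultiplication of `A⁰`: the element `Δ f` of `A⁰ ⊗ A⁰` is the unique one with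
`(Δ f)(a ⊗ b) = f (a b)`. -/
def comul : FiniteDual k A →ₗ[k] FiniteDual k A ⊗[k] FiniteDual k A :=
  (LinearEquiv.ofInjective (pairing k A) (pairing_injective k A)).symm.toLinearMap ∘ₗ
    LinearMap.codRestrict (LinearMap.range (pairing k A))
      (Module.Dual.transpose (R := k) (LinearMap.mul' k A) ∘ₗ incl k A)
      comp_mul_mem_range

/-- The counit of `A⁰`: `ε f = f 1`. -/
def counit : FiniteDual k A →ₗ[k] k := ev k A 1

variable {k A} in
theorem pairing_comul (f : FiniteDual k A) :
    pairing k A (comul k A f) = f.1 ∘ₗ LinearMap.mul' k A :=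
  congrArg Subtype.val
    ((LinearEquiv.ofInjective (pairing k A) (pairing_injective k A)).apply_symm_apply _)

variable {k A} in
theorem dualDistrib_comul (f : FiniteDual k A) (a b : A) :
    TensorProduct.dualDistrib k _ _ (ev k A a ⊗ₜ ev k A b) (comul k A f) = f.1 (a * b) := by
  rw [← pairing_apply_tmul, pairing_comul]
  simp

instance : Coalgebra k (FiniteDual k A) where
  comul := comul k A
  counit := counit k A
  coassoc := by
    ext1 f
    rw [← sub_eq_zero]
    refine eq_zero_of_dualDistrib (ev k A)
      (fun p : A × A => TensorProduct.dualDistrib k _ _ (ev k A p.1 ⊗ₜ ev k A p.2))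
      (ev_sep k A)
      (fun t ht => eq_zero_of_dualDistrib (ev k A) (ev k A) (ev_sep k A) (ev_sep k A) t
        fun a b => ht (a, b)) _ ?_
    rintro a ⟨b, c⟩
    rw [map_sub, sub_eq_zero]
    have h1 : ∀ t : FiniteDual k A ⊗[k] FiniteDual k A,
        TensorProduct.dualDistrib k _ _
          (ev k A a ⊗ₜ TensorProduct.dualDistrib k _ _ (ev k A b ⊗ₜ ev k A c))
          ((comul k A).lTensor _ t) =
        TensorProduct.dualDistrib k _ _ (ev k A a ⊗ₜ ev k A (b * c)) t := by
      intro t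
      induction t with
      | zero => simp
      | tmul f g =>
        rw [LinearMap.lTensor_tmul, TensorProduct.dualDistrib_apply, dualDistrib_comul]; rfl
      | add x y hx hy => simp only [map_add, hx, hy]
    have h2 : ∀ t : (FiniteDual k A ⊗[k] FiniteDual k A) ⊗[k] FiniteDual k A,
        TensorProduct.dualDistrib k _ _
          (ev k A a ⊗ₜ TensorProduct.dualDistrib k _ _ (ev k A b ⊗ₜ ev k A c))
          (TensorProduct.assoc k _ _ _ t) =
        TensorProduct.dualDistrib k _ _
          (TensorProduct.dualDistrib k _ _ (ev k A a ⊗ₜ ev k A b) ⊗ₜ ev k A c) t := by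
      intro t
      induction t with
      | zero => simp
      | tmul s h =>
        induction s with
        | zero => simp
        | tmul f g => simp [mul_assoc]
        | add x y hx hy => simp only [TensorProduct.add_tmul, map_add, hx, hy]
      | add x y hx hy => simp only [map_add, hx, hy]
    have h3 : ∀ t : FiniteDual k A ⊗[k] FiniteDual k A,
        TensorProduct.dualDistrib k _ _
          (TensorProduct.dualDistrib k _ _ (ev k A a ⊗ₜ ev k A b) ⊗ₜ ev k A c)
          ((comul k A).rTensor _ t) =
        TensorProduct.dualDistrib k _ _ (ev k A (a * b) ⊗ₜ ev k A c) t := by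
      intro t
      induction t with
      | zero => simp
      | tmul f g =>
        rw [LinearMap.rTensor_tmul, TensorProduct.dualDistrib_apply, dualDistrib_comul]; rfl
      | add x y hx hy => simp only [map_add, hx, hy]
    simp only [LinearMap.comp_apply, LinearEquiv.coe_coe]
    rw [h1, h2, h3, dualDistrib_comul, dualDistrib_comul, mul_assoc]
  rTensor_counit_comp_comul := by
    ext1 f
    apply (TensorProduct.lid k _).injective
    rw [← sub_eq_zero]
    apply ev_sep
    intro a
    have h : ∀ t : FiniteDual k A ⊗[k] FiniteDual k A,
        ev k A a (TensorProduct.lid k _ ((counit k A).rTensor _ t)) =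
          TensorProduct.dualDistrib k _ _ (ev k A 1 ⊗ₜ ev k A a) t := by
      intro t
      induction t with
      | zero => simp only [map_zero]
      | tmul f g => simp [counit]
      | add x y hx hy => simp only [map_add, hx, hy]
    rw [map_sub, LinearMap.comp_apply, h, dualDistrib_comul]
    simp
  lTensor_counit_comp_comul := by
    ext1 f
    apply (TensorProduct.rid k _).injective
    rw [← sub_eq_zero]
    apply ev_sep
    intro a
    have h : ∀ t : FiniteDual k A ⊗[k] FiniteDual k A,
        ev k A a (TensorProduct.rid k _ ((counit k A).lTensor _ t)) =
          TensorProduct.dualDistrib k _ _ (ev k A a ⊗ₜ ev k A 1) t := by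
      intro t
      induction t with
      | zero => simp only [map_zero]
      | tmul f g => simp [counit, mul_comm]
      | add x y hx hy => simp only [map_add, hx, hy]
    rw [map_sub, LinearMap.comp_apply, h, dualDistrib_comul]
    simp

variable {k A} {B : Type*} [Ring B] [Algebra k B]

/-- The coalgebra map `B⁰ → A⁰`, `f ↦ f ∘ φ`, induced by an algebra map `φ : A → B`. -/
def map (φ : A →ₐ[k] B) : FiniteDual k B →ₗc[k] FiniteDual k A :=
  let r : FiniteDual k B →ₗ[k] FiniteDual k A :=
    LinearMap.codRestrict (finiteDualSubmodule k A)
      (Module.Dual.transpose (R := k) φ.toLinearMap ∘ₗ incl k B) <| by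
      rintro ⟨f, I, hI, hfin, hf⟩
      refine ⟨I.comap φ, inferInstance, ?_, fun a ha => hf _ ha⟩
      let p : A →ₗ[k] B ⧸ I := (I.mkQ.restrictScalars k) ∘ₗ φ.toLinearMap
      have hp : LinearMap.ker p = (I.comap φ).restrictScalars k := by
        ext x
        simp [p, Ideal.Quotient.eq_zero_iff_mem]
      let q := (LinearMap.ker p).liftQ p le_rfl
      have hq : Function.Injective q := by
        rw [← LinearMap.ker_eq_bot]; exact Submodule.ker_liftQ_eq_bot _ _ _ le_rfl
      have := Module.Finite.of_injective q hq
      rw [hp] at this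
      exact this
  have hr : ∀ f a, (r f).1 a = f.1 (φ a) := fun _ _ => rfl
  { r with
    counit_comp := by
      ext1 f
      change (r f).1 1 = f.1 1
      rw [hr, map_one]
    map_comp_comul := by
      ext1 f
      rw [← sub_eq_zero]
      refine eq_zero_of_dualDistrib (ev k A) (ev k A) (ev_sep k A) (ev_sep k A) _ fun a b => ?_
      have h : ∀ t : FiniteDual k B ⊗[k] FiniteDual k B,
          TensorProduct.dualDistrib k _ _ (ev k A a ⊗ₜ ev k A b) (TensorProduct.map r r t) =
            TensorProduct.dualDistrib k _ _ (ev k B (φ a) ⊗ₜ ev k B (φ b)) t := by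
        intro t
        induction t with
        | zero => simp
        | tmul f g => simp [hr]
        | add x y hx hy => simp only [map_add, hx, hy]
      rw [map_sub, sub_eq_zero]
      refine (h (comul k B f)).trans ?_
      refine Eq.trans ?_ (dualDistrib_comul (r f) a b).symm
      rw [hr, map_mul]
      exact dualDistrib_comul f (φ a) (φ b) }

@[simp]
theorem map_apply (φ : A →ₐ[k] B) (f : FiniteDual k B) (a : A) :
    (map φ f).1 a = f.1 (φ a) := rfl

end FiniteDual

end FiniteDual


section Topological

variable (k : Type u) [Field k] [TopologicalSpace k] [IsTopologicalRing k]

/-- The weak-`*` topology on the algebraic dual: the coarsest topology for which all evaluations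
`ℓ ↦ ℓ v` are continuous. -/
instance weakStarTopology (V : Type*) [AddCommMonoid V] [Module k V] :
    TopologicalSpace (Module.Dual k V) :=
  TopologicalSpace.induced (fun ℓ v => ℓ v) Pi.topologicalSpace

section Unbundled

variable {k} {V W : Type*} [AddCommMonoid V] [Module k V] [AddCommMonoid W] [Module k W]

theorem continuous_eval (v : V) : Continuous fun ℓ : Module.Dual k V => ℓ v :=
  (continuous_apply v).comp continuous_induced_dom

theorem continuous_of_eval {E : Type*} [TopologicalSpace E] {g : E → Module.Dual k V}
    (h : ∀ v, Continuous fun x => g x v) : Continuous g :=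
  continuous_induced_rng.2 (continuous_pi h)

instance : ContinuousAdd (Module.Dual k V) :=
  ⟨continuous_of_eval fun v =>
    ((continuous_eval v).comp continuous_fst).add ((continuous_eval v).comp continuous_snd)⟩

instance : ContinuousSMul k (Module.Dual k V) :=
  ⟨continuous_of_eval fun v =>
    continuous_fst.mul ((continuous_eval v).comp continuous_snd)⟩

/-- The algebraic transpose `f^* : W^* → V^*` as a continuous linear map. -/
def transposeL (f : V →ₗ[k] W) : Module.Dual k W →L[k] Module.Dual k V :=
  ⟨Module.Dual.transpose (R := k) f, continuous_of_eval fun v => continuous_eval (f v)⟩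

@[simp]
theorem transposeL_apply (f : V →ₗ[k] W) (ℓ : Module.Dual k W) (v : V) :
    transposeL f ℓ v = ℓ (f v) := rfl

variable (k V) in
/-- The canonical map `Λ : V → (V^*)'`, `Λ v ℓ = ℓ v`. -/
def dualEval : V →ₗ[k] (Module.Dual k V →L[k] k) where
  toFun v := ⟨Module.Dual.eval k V v, continuous_eval v⟩
  map_add' v w := by ext ℓ; exact map_add ℓ v w
  map_smul' c v := by ext ℓ; exact map_smul ℓ c v

@[simp]
theorem dualEval_apply (v : V) (ℓ : Module.Dual k V) : dualEval k V v ℓ = ℓ v := rfl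

theorem dualEval_injective : Function.Injective (dualEval k V) := by
  let _ : AddCommGroup V := Module.addCommMonoidToAddCommGroup k
  intro v w h
  rw [← sub_eq_zero]
  refine (Module.forall_dual_apply_eq_zero_iff k _).1 fun ℓ => ?_
  rw [map_sub, sub_eq_zero]
  exact congrArg (fun F : Module.Dual k V →L[k] k => F ℓ) h

theorem dualEval_surjective [T2Space k] : Function.Surjective (dualEval k V) := by
  intro F
  -- a neighbourhood `U` of `0` missing `1` contains no nonzero subspace of `k`
  have hU : {x : k | x ≠ 1} ∈ nhds (0 : k) := isOpen_ne.mem_nhds zero_ne_one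
  have hF : F ⁻¹' {x : k | x ≠ 1} ∈ nhds (0 : Module.Dual k V) :=
    F.continuous.continuousAt.preimage_mem_nhds (by rw [map_zero]; exact hU)
  rw [nhds_induced, Filter.mem_comap] at hF
  obtain ⟨t, ht, htF⟩ := hF
  rw [nhds_pi, Filter.mem_pi] at ht
  obtain ⟨I, hI, s, hs, hst⟩ := ht
  have hker : (⨅ i : I, LinearMap.ker (Module.Dual.eval k V i)) ≤
      LinearMap.ker (F : Module.Dual k V →ₗ[k] k) := by
    intro ℓ hℓ
    simp only [Submodule.mem_iInf, LinearMap.mem_ker, Module.Dual.eval_apply] at hℓ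
    by_contra hne
    have hne : F ℓ ≠ 0 := hne
    have hm : (F ℓ)⁻¹ • ℓ ∈ F ⁻¹' {x : k | x ≠ 1} := by
      apply htF
      apply hst
      intro i hi
      have h0 : ((F ℓ)⁻¹ • ℓ) i = 0 := by
        rw [LinearMap.smul_apply, hℓ ⟨i, hi⟩, smul_zero]
      change ((F ℓ)⁻¹ • ℓ) i ∈ s i
      rw [h0]
      exact mem_of_mem_nhds (hs i)
    apply hm
    rw [map_smul, smul_eq_mul, inv_mul_cancel₀ hne]
  have := hI.to_subtype
  have hspan := mem_span_of_iInf_ker_le_ker hker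
  have hle : Submodule.span k (Set.range fun i : I => Module.Dual.eval k V i) ≤
      LinearMap.range (Module.Dual.eval k V) := by
    rw [Submodule.span_le]
    rintro _ ⟨i, rfl⟩
    exact ⟨i, rfl⟩
  obtain ⟨v, hv⟩ := hle hspan
  exact ⟨v, ContinuousLinearMap.ext fun ℓ => LinearMap.congr_fun hv ℓ⟩

variable (k V) in
/-- The isomorphism `Λ : V ≃ (V^*)'`. -/
def dualEvalEquiv [T2Space k] : V ≃ₗ[k] (Module.Dual k V →L[k] k) :=
  LinearEquiv.ofBijective (dualEval k V) ⟨dualEval_injective, dualEval_surjective⟩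

@[simp]
theorem dualEvalEquiv_apply [T2Space k] (v : V) (ℓ : Module.Dual k V) :
    dualEvalEquiv k V v ℓ = ℓ v := rfl

variable (k) in
/-- The isomorphism `((k^{(S)})^*, w^*) ≃ k^S` of topological vector spaces. -/
def dualFinsuppEquiv (S : Type*) : Module.Dual k (S →₀ k) ≃L[k] (S → k) where
  toFun ℓ x := ℓ (Finsupp.single x 1)
  map_add' _ _ := rfl
  map_smul' _ _ := rfl
  invFun f := Finsupp.linearCombination k f
  left_inv ℓ := by ext x; simp
  right_inv f := by ext x; simp
  continuous_toFun := continuous_pi fun x => continuous_eval _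
  continuous_invFun := continuous_of_eval fun p => by
    simp only [Finsupp.linearCombination_apply, Finsupp.sum]
    exact continuous_finsetSum _ fun x _ => (continuous_apply x).const_smul (p x)

variable (k) in
/-- The canonical map `Γ : E → (E')^*`, `Γ u ℓ = ℓ u`, for a topological vector space `E`. -/
def bidualL (E : Type*) [AddCommGroup E] [Module k E] [TopologicalSpace E] :
    E →L[k] Module.Dual k (E →L[k] k) where
  toFun u :=
    { toFun := fun ℓ => ℓ u
      map_add' := fun _ _ => rfl
      map_smul' := fun _ _ => rfl }
  map_add' u v := by ext ℓ; exact map_add ℓ u v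
  map_smul' c u := by ext ℓ; exact map_smul ℓ c u
  cont := continuous_of_eval fun ℓ => ℓ.continuous

@[simp]
theorem bidualL_apply {E : Type*} [AddCommGroup E] [Module k E] [TopologicalSpace E]
    (u : E) (ℓ : E →L[k] k) : bidualL k E u ℓ = ℓ u := rfl

/-- The topological transpose `f' : F' → E'`, `f' ℓ = ℓ ∘ f`. -/
def topTranspose {E F : Type*} [AddCommGroup E] [Module k E] [TopologicalSpace E]
    [AddCommGroup F] [Module k F] [TopologicalSpace F] (f : E →L[k] F) :
    (F →L[k] k) →ₗ[k] (E →L[k] k) where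
  toFun ℓ := ℓ.comp f
  map_add' _ _ := rfl
  map_smul' _ _ := rfl

@[simp]
theorem topTranspose_apply {E F : Type*} [AddCommGroup E] [Module k E] [TopologicalSpace E]
    [AddCommGroup F] [Module k F] [TopologicalSpace F] (f : E →L[k] F) (ℓ : F →L[k] k) (u : E) :
    topTranspose f ℓ u = ℓ (f u) := rfl

/-- If `E` is isomorphic to the algebraic dual of some `V`, then `Γ : E → (E')^*` is an
isomorphism, with inverse `(E')^* → ((V^*)')^* → V^* → E`. -/
def bidualEquivOfDual [T2Space k] {E : Type*} [AddCommGroup E] [Module k E] [TopologicalSpace E]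
    (e : E ≃L[k] Module.Dual k V) : E ≃L[k] Module.Dual k (E →L[k] k) :=
  ContinuousLinearEquiv.equivOfInverse (bidualL k E)
    ((e.symm : Module.Dual k V →L[k] E).comp
      (transposeL (topTranspose (e : E →L[k] Module.Dual k V) ∘ₗ dualEval k V)))
    (by
      intro u
      apply e.injective
      ext v
      simp)
    (by
      intro L
      ext ℓ
      obtain ⟨v, hv⟩ := dualEval_surjective (ℓ.comp (e.symm : Module.Dual k V →L[k] E))
      have h : ∀ m, ℓ (e.symm m) = m v := fun m =>
        (congrArg (fun F : Module.Dual k V →L[k] k => F m) hv).symm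
      simp only [bidualL_apply, ContinuousLinearMap.comp_apply, ContinuousLinearEquiv.coe_coe, h,
        transposeL_apply, LinearMap.comp_apply]
      congr 1
      ext u
      simp [← h])

/-- The algebraic transpose of a linear isomorphism, as an isomorphism of topological vector
spaces. -/
def transposeEquiv (e : V ≃ₗ[k] W) : Module.Dual k W ≃L[k] Module.Dual k V :=
  ContinuousLinearEquiv.equivOfInverse (transposeL e.toLinearMap) (transposeL e.symm.toLinearMap)
    (fun ℓ => by ext w; simp) (fun ℓ => by ext v; simp)

@[simp]
theorem transposeEquiv_apply (e : V ≃ₗ[k] W) (ℓ : Module.Dual k W) (v : V) :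
    transposeEquiv e ℓ v = ℓ (e v) := rfl

variable {E F G H : Type*}
  [AddCommGroup E] [Module k E] [TopologicalSpace E]
  [AddCommGroup F] [Module k F] [TopologicalSpace F]
  [AddCommGroup G] [Module k G] [TopologicalSpace G]
  [AddCommGroup H] [Module k H] [TopologicalSpace H]

variable (k E F) in
/-- The underlying space of the topological tensor product `E ⊛ F = (E' ⊗ F')^*`. -/
abbrev TTensor : Type _ := Module.Dual k ((E →L[k] k) ⊗[k] (F →L[k] k))

variable (k) in
/-- The element `u ⊛ v` of `E ⊛ F`, `(u ⊛ v)(ℓ₁ ⊗ ℓ₂) = ℓ₁(u) ℓ₂(v)`. -/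
def tpure (u : E) (v : F) : TTensor k E F :=
  TensorProduct.dualDistrib k _ _ (bidualL k E u ⊗ₜ bidualL k F v)

@[simp]
theorem tpure_apply (u : E) (v : F) (ℓ₁ : E →L[k] k) (ℓ₂ : F →L[k] k) :
    tpure k u v (ℓ₁ ⊗ₜ ℓ₂) = ℓ₁ u * ℓ₂ v := rfl

variable (k) in
/-- The bilinear map `(u, v) ↦ u ⊛ v`. -/
def tpureBilin : E →ₗ[k] F →ₗ[k] TTensor k E F :=
  LinearMap.mk₂ k (tpure k)
    (fun u u' v => by
      apply TensorProduct.ext'; intro a b; simp [add_mul])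
    (fun c u v => by
      apply TensorProduct.ext'; intro a b; simp [mul_assoc])
    (fun u v v' => by
      apply TensorProduct.ext'; intro a b; simp [mul_add])
    (fun c u v => by
      apply TensorProduct.ext'; intro a b; simp [mul_left_comm])

theorem continuous_tpure_left (v : F) : Continuous fun u : E => tpure k u v := by
  refine continuous_of_eval fun t => ?_
  induction t with
  | zero => simp only [map_zero]; exact continuous_const
  | tmul a b => simp only [tpure_apply]; exact a.continuous.mul continuous_const
  | add x y hx hy => simp only [map_add]; exact hx.add hy

theorem continuous_tpure_right (u : E) : Continuous fun v : F => tpure k u v := by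
  refine continuous_of_eval fun t => ?_
  induction t with
  | zero => simp only [map_zero]; exact continuous_const
  | tmul a b => simp only [tpure_apply]; exact continuous_const.mul b.continuous
  | add x y hx hy => simp only [map_add]; exact hx.add hy

/-- The continuous linear map `u ↦ u ⊛ v`. -/
def tpureLeftL (v : F) : E →L[k] TTensor k E F :=
  ⟨(tpureBilin k).flip v, continuous_tpure_left v⟩

/-- The continuous linear map `v ↦ u ⊛ v`. -/
def tpureRightL (u : E) : F →L[k] TTensor k E F :=
  ⟨tpureBilin k u, continuous_tpure_right u⟩

@[simp]
theorem tpureLeftL_apply (u : E) (v : F) : tpureLeftL (k := k) v u = tpure k u v := rfl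

@[simp]
theorem tpureRightL_apply (u : E) (v : F) : tpureRightL (k := k) u v = tpure k u v := rfl

/-- A continuous linear map out of `E ⊛ F` is determined by its values on the `u ⊛ v`. -/
theorem tTensor_ext [T2Space k] {f g : TTensor k E F →L[k] G}
    (hG : Function.Injective (bidualL k G)) (h : ∀ u v, f (tpure k u v) = g (tpure k u v)) :
    f = g := by
  ext x
  apply hG
  ext ℓ
  simp only [bidualL_apply]
  have hs : ∀ s : TTensor k E F →L[k] k, (∀ u v, s (tpure k u v) = 0) → s = 0 := by
    intro s hs
    obtain ⟨t, rfl⟩ := dualEval_surjective s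
    have : t = 0 := by
      refine eq_zero_of_dualDistrib (fun u => bidualL k E u) (fun v => bidualL k F v) ?_ ?_ t hs
      · intro a ha; ext u; exact ha u
      · intro a ha; ext u; exact ha u
    rw [this, map_zero]
  have h0 := hs (ℓ.comp f - ℓ.comp g) fun u v => by simp [h]
  have := congrArg (fun s : TTensor k E F →L[k] k => s x) h0
  simpa [sub_eq_zero] using this

/-- The map `f ⊛ g = (f' ⊗ g')^*`. -/
def tmapL (f : E →L[k] G) (g : F →L[k] H) : TTensor k E F →L[k] TTensor k G H :=
  transposeL (TensorProduct.map (topTranspose f) (topTranspose g))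

@[simp]
theorem tmapL_tpure (f : E →L[k] G) (g : F →L[k] H) (u : E) (v : F) :
    tmapL f g (tpure k u v) = tpure k (f u) (g v) :=
  TensorProduct.ext' fun _ _ => rfl

variable [T2Space k]

variable (k E F G) in
/-- The associativity isomorphism `(E ⊛ F) ⊛ G ≃ E ⊛ (F ⊛ G)`, obtained from the associativity of
`⊗` through `(E ⊛ F)' ≃ E' ⊗ F'`. -/
def tassoc : TTensor k (TTensor k E F) G ≃L[k] TTensor k E (TTensor k F G) :=
  transposeEquiv
    (TensorProduct.congr (LinearEquiv.refl k (E →L[k] k)) (dualEvalEquiv k _).symm ≪≫ₗ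
      (TensorProduct.assoc k (E →L[k] k) (F →L[k] k) (G →L[k] k)).symm ≪≫ₗ
      TensorProduct.congr (dualEvalEquiv k _) (LinearEquiv.refl k (G →L[k] k)))

@[simp]
theorem tassoc_tpure (u : E) (v : F) (w : G) :
    tassoc k E F G (tpure k (tpure k u v) w) = tpure k u (tpure k v w) := by
  apply TensorProduct.ext'
  intro a b
  obtain ⟨t, rfl⟩ := (dualEvalEquiv k ((F →L[k] k) ⊗[k] (G →L[k] k))).surjective b
  simp only [tassoc, transposeEquiv_apply, tpure_apply, dualEvalEquiv_apply,
    LinearEquiv.trans_apply, TensorProduct.congr_tmul, LinearEquiv.refl_apply,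
    LinearEquiv.symm_apply_apply]
  induction t with
  | zero => simp
  | tmul b c => simp [mul_assoc]
  | add x y hx hy => simp only [TensorProduct.tmul_add, map_add, mul_add, hx, hy]

variable (k) in
/-- The isomorphism `ψ : k ≃ k'`, `ψ 1 = id`. -/
def unitDual : k ≃ₗ[k] (k →L[k] k) where
  toFun c := c • ContinuousLinearMap.id k k
  map_add' a b := by ext; simp
  map_smul' a b := by ext; simp
  invFun ℓ := ℓ 1
  left_inv c := by simp
  right_inv ℓ := by ext; simp

@[simp]
theorem unitDual_apply (c x : k) : unitDual k c x = c * x := by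
  simp [unitDual]

variable (k F) in
/-- The isomorphism `k ⊛ F ≃ (F')^*`, obtained from `k' ⊗ F' ≃ F'`. -/
def tlidDual : TTensor k k F ≃L[k] Module.Dual k (F →L[k] k) :=
  transposeEquiv ((TensorProduct.lid k (F →L[k] k)).symm ≪≫ₗ
    TensorProduct.congr (unitDual k) (LinearEquiv.refl k (F →L[k] k)))

theorem tlidDual_tpure (c : k) (v : F) : tlidDual k F (tpure k c v) = bidualL k F (c • v) := by
  ext ℓ
  simp [tlidDual]

variable (k E) in
/-- The isomorphism `E ⊛ k ≃ (E')^*`, obtained from `E' ⊗ k' ≃ E'`. -/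
def tridDual : TTensor k E k ≃L[k] Module.Dual k (E →L[k] k) :=
  transposeEquiv ((TensorProduct.rid k (E →L[k] k)).symm ≪≫ₗ
    TensorProduct.congr (LinearEquiv.refl k (E →L[k] k)) (unitDual k))

theorem tridDual_tpure (c : k) (u : E) : tridDual k E (tpure k u c) = bidualL k E (c • u) := by
  ext ℓ
  simp [tridDual, mul_comm]

/-- The map `k → k^*`, `1 ↦ id`. -/
def unitAlgDual : k →L[k] Module.Dual k k where
  toFun c := c • LinearMap.id
  map_add' a b := add_smul a b _
  map_smul' a b := mul_smul a b _
  cont := continuous_of_eval fun v => continuous_id.mul continuous_const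

end Unbundled

variable [T2Space k]

/-- A topological vector space is topologically free if it is isomorphic to `k^S`, with the
product topology, for some set `S`. -/
def IsTopFree : ObjectProperty (TopModuleCat.{u} k) :=
  fun E => ∃ S : Type u, Nonempty (E ≃L[k] (S → k))

/-- The category of topologically free vector spaces and continuous linear maps. -/
abbrev TopFreeVect : Type (u + 1) := (IsTopFree k).FullSubcategory

namespace TopFreeVect

variable {k}

instance : CoeSort (TopFreeVect k) (Type u) := ⟨fun X => X.obj⟩

/-- The continuous linear map underlying a morphism. -/
def app {X Y : TopFreeVect k} (f : X ⟶ Y) : X →L[k] Y := f.hom.hom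

/-- The morphism given by a continuous linear map. -/
def mk {X Y : TopFreeVect k} (f : X →L[k] Y) : X ⟶ Y :=
  ObjectProperty.homMk (ConcreteCategory.ofHom f)

@[simp]
theorem app_mk {X Y : TopFreeVect k} (f : X →L[k] Y) : app (mk f) = f := rfl

@[simp]
theorem app_id (X : TopFreeVect k) : app (𝟙 X) = ContinuousLinearMap.id k X := rfl

@[simp]
theorem app_comp {X Y Z : TopFreeVect k} (f : X ⟶ Y) (g : Y ⟶ Z) :
    app (f ≫ g) = (app g).comp (app f) := rfl

theorem app_injective {X Y : TopFreeVect k} {f g : X ⟶ Y} (h : app f = app g) : f = g :=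
  ObjectProperty.hom_ext _ (ConcreteCategory.hom_ext _ _ fun x =>
    congrArg (fun F : X →L[k] Y => F x) h)

/-- The isomorphism given by an isomorphism of topological vector spaces. -/
def isoMk {X Y : TopFreeVect k} (e : X ≃L[k] Y) : X ≅ Y where
  hom := mk (e : X →L[k] Y)
  inv := mk (e.symm : Y →L[k] X)
  hom_inv_id := app_injective (by ext x; simp)
  inv_hom_id := app_injective (by ext x; simp)

theorem exists_equiv_dual (X : TopFreeVect k) :
    ∃ S : Type u, Nonempty (X ≃L[k] Module.Dual k (S →₀ k)) := by
  obtain ⟨S, ⟨e⟩⟩ := X.property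
  exact ⟨S, ⟨e.trans (dualFinsuppEquiv k S).symm⟩⟩

/-- The isomorphism `Γ : X ≃ (X')^*`, `Γ u ℓ = ℓ u`. -/
def gamma (X : TopFreeVect k) : X ≃L[k] Module.Dual k (X →L[k] k) :=
  bidualEquivOfDual (exists_equiv_dual X).choose_spec.some

@[simp]
theorem gamma_apply (X : TopFreeVect k) (u : X) : gamma X u = bidualL k X u := rfl

theorem bidualL_injective (X : TopFreeVect k) : Function.Injective (bidualL k X) :=
  (gamma X).injective

variable (k)

/-- The algebraic dual of a vector space, with the weak-`*` topology, is topologically free. -/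
def algDual (V : Type u) [AddCommGroup V] [Module k V] : TopFreeVect k where
  obj := TopModuleCat.of k (Module.Dual k V)
  property := ⟨_, ⟨(transposeEquiv (Module.Basis.ofVectorSpace k V).repr.symm).trans
    (dualFinsuppEquiv k _)⟩⟩

/-- The algebraic dual functor `V ↦ (V^*, w^*)`. -/
def Alg : (ModuleCat.{u} k)ᵒᵖ ⥤ TopFreeVect k where
  obj V := algDual k V.unop
  map f := mk (X := algDual k _) (Y := algDual k _) (transposeL f.unop.hom)
  map_id V := rfl
  map_comp f g := rfl

/-- The topological dual functor `X ↦ X'`. -/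
def Top : (TopFreeVect k)ᵒᵖ ⥤ ModuleCat.{u} k where
  obj X := ModuleCat.of k (X.unop →L[k] k)
  map f := ModuleCat.ofHom (topTranspose (app f.unop))
  map_id X := rfl
  map_comp f g := rfl

/-- The topological tensor product `X ⊛ Y`, the algebraic dual of `X' ⊗ Y'`. -/
def tensor (X Y : TopFreeVect k) : TopFreeVect k :=
  (Alg k).obj (op ((Top k).obj (op X) ⊗ (Top k).obj (op Y)))

/-- The base field with its topology. -/
def unit : TopFreeVect k where
  obj := TopModuleCat.of k k
  property := ⟨PUnit, ⟨(ContinuousLinearEquiv.funUnique PUnit k k).symm⟩⟩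

variable {k}

/-- The map `f ⊛ g`, the algebraic transpose of `f' ⊗ g'`. -/
def tensorMap {X₁ Y₁ X₂ Y₂ : TopFreeVect k} (f : X₁ ⟶ Y₁) (g : X₂ ⟶ Y₂) :
    tensor k X₁ X₂ ⟶ tensor k Y₁ Y₂ :=
  (Alg k).map ((Top k).map f.op ⊗ₘ (Top k).map g.op).op

instance : MonoidalCategoryStruct (TopFreeVect k) where
  tensorObj X Y := tensor k X Y
  tensorHom f g := tensorMap f g
  whiskerLeft X _ _ f := tensorMap (𝟙 X) f
  whiskerRight f Y := tensorMap f (𝟙 Y)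
  tensorUnit := unit k
  associator X Y Z := isoMk (X := tensor k (tensor k X Y) Z) (Y := tensor k X (tensor k Y Z))
    (tassoc k X Y Z)
  leftUnitor X := isoMk (X := tensor k (unit k) X) (Y := X) ((tlidDual k X).trans (gamma X).symm)
  rightUnitor X := isoMk (X := tensor k X (unit k)) (Y := X) ((tridDual k X).trans (gamma X).symm)

/-- The element `u ⊛ v` of `X ⊛ Y`. -/
def pure {X Y : TopFreeVect k} (u : X) (v : Y) : (X ⊗ Y : TopFreeVect k) := tpure k u v

theorem tensor_ext {X Y Z : TopFreeVect k} {f g : X ⊗ Y ⟶ Z}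
    (h : ∀ (u : X) (v : Y), app f (pure u v) = app g (pure u v)) : f = g :=
  app_injective (tTensor_ext (E := X) (F := Y) (f := app f) (g := app g) (bidualL_injective Z) h)

theorem tensor_ext₃ {X Y Z W : TopFreeVect k} {f g : (X ⊗ Y) ⊗ Z ⟶ W}
    (h : ∀ (u : X) (v : Y) (w : Z), app f (pure (pure u v) w) = app g (pure (pure u v) w)) :
    f = g := by
  apply tensor_ext
  intro s w
  have : (app f).comp (tpureLeftL (k := k) (E := (X ⊗ Y : TopFreeVect k)) (F := Z) w) =
      (app g).comp (tpureLeftL (k := k) (E := (X ⊗ Y : TopFreeVect k)) (F := Z) w) :=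
    tTensor_ext (E := X) (F := Y) (bidualL_injective W) fun u v => h u v w
  exact congrArg (fun F : (X ⊗ Y : TopFreeVect k) →L[k] W => F s) this

theorem tensor_ext₄ {X Y Z T W : TopFreeVect k} {f g : ((X ⊗ Y) ⊗ Z) ⊗ T ⟶ W}
    (h : ∀ (u : X) (v : Y) (w : Z) (t : T),
      app f (pure (pure (pure u v) w) t) = app g (pure (pure (pure u v) w) t)) :
    f = g := by
  apply tensor_ext₃
  intro s w t
  have : ((app f).comp (tpureLeftL (k := k) (E := ((X ⊗ Y) ⊗ Z : TopFreeVect k)) (F := T) t)).comp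
        (tpureLeftL (k := k) (E := (X ⊗ Y : TopFreeVect k)) (F := Z) w) =
      ((app g).comp (tpureLeftL (k := k) (E := ((X ⊗ Y) ⊗ Z : TopFreeVect k)) (F := T) t)).comp
        (tpureLeftL (k := k) (E := (X ⊗ Y : TopFreeVect k)) (F := Z) w) :=
    tTensor_ext (E := X) (F := Y) (bidualL_injective W) fun u v => h u v w t
  exact congrArg (fun F : (X ⊗ Y : TopFreeVect k) →L[k] W => F s) this

@[simp]
theorem tensorHom_pure {X₁ Y₁ X₂ Y₂ : TopFreeVect k} (f : X₁ ⟶ Y₁) (g : X₂ ⟶ Y₂)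
    (u : X₁) (v : X₂) : app (f ⊗ₘ g) (pure u v) = pure (app f u) (app g v) :=
  tmapL_tpure (k := k) (app f) (app g) u v

@[simp]
theorem associator_pure {X Y Z : TopFreeVect k} (u : X) (v : Y) (w : Z) :
    app (α_ X Y Z).hom (pure (pure u v) w) = pure u (pure v w) :=
  tassoc_tpure (k := k) u v w

@[simp]
theorem leftUnitor_pure {X : TopFreeVect k} (c : k) (u : X) :
    app (λ_ X).hom (pure (X := 𝟙_ (TopFreeVect k)) c u) = c • u :=
  (congrArg (gamma X).symm (tlidDual_tpure c u)).trans ((gamma X).symm_apply_apply _)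

@[simp]
theorem rightUnitor_pure {X : TopFreeVect k} (c : k) (u : X) :
    app (ρ_ X).hom (pure (Y := 𝟙_ (TopFreeVect k)) u c) = c • u :=
  (congrArg (gamma X).symm (tridDual_tpure c u)).trans ((gamma X).symm_apply_apply _)

theorem pure_smul {X Y : TopFreeVect k} (c : k) (u : X) (v : Y) :
    pure u (c • v) = pure (c • u) v :=
  ((tpureBilin k u).map_smul c v).trans
    (((tpureBilin k).flip v).map_smul c u).symm

instance : MonoidalCategory (TopFreeVect k) := MonoidalCategory.ofTensorHom
  (id_tensorHom_id := fun X Y => tensor_ext fun u v => by simp)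
  (id_tensorHom := fun X _ _ f => rfl)
  (tensorHom_id := fun f Y => rfl)
  (tensorHom_comp_tensorHom := fun f₁ f₂ g₁ g₂ => tensor_ext fun u v => by simp)
  (associator_naturality := fun f₁ f₂ f₃ => tensor_ext₃ fun u v w => by simp)
  (leftUnitor_naturality := fun {X Y} f => tensor_ext fun (c : k) v => by
    simp only [app_comp, ContinuousLinearMap.comp_apply]
    refine (congrArg (app (λ_ Y).hom)
      (tensorHom_pure (X₁ := 𝟙_ (TopFreeVect k)) (𝟙 _) f c v)).trans ?_
    exact (leftUnitor_pure (X := Y) c (app f v)).trans ((map_smul (app f) c v).symm.trans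
      (congrArg (app f) (leftUnitor_pure (X := X) c v).symm)))
  (rightUnitor_naturality := fun {X Y} f => tensor_ext fun u (c : k) => by
    simp only [app_comp, ContinuousLinearMap.comp_apply]
    refine (congrArg (app (ρ_ Y).hom)
      (tensorHom_pure (X₂ := 𝟙_ (TopFreeVect k)) f (𝟙 _) u c)).trans ?_
    exact (rightUnitor_pure (X := Y) c (app f u)).trans ((map_smul (app f) c u).symm.trans
      (congrArg (app f) (rightUnitor_pure (X := X) c u).symm)))
  (pentagon := fun W X Y Z => tensor_ext₄ fun u v w t => by simp)
  (triangle := fun X Y => tensor_ext₃ fun u c v => by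
    simp only [app_comp, ContinuousLinearMap.comp_apply]
    rw [tensorHom_pure, associator_pure, tensorHom_pure]
    exact (congrArg (pure u) (leftUnitor_pure (X := Y) c v)).trans ((pure_smul (k := k) c u v).trans
      (congrArg (fun s => pure s v) (rightUnitor_pure (X := X) c u).symm)))

variable (k)

/-- The forgetful functor to vector spaces. -/
def forget : TopFreeVect k ⥤ ModuleCat.{u} k :=
  (IsTopFree k).ι ⋙ forget₂ (TopModuleCat k) (ModuleCat k)

/-- The forgetful functor is lax monoidal through `Ξ : u ⊗ v ↦ u ⊛ v` and the identity of `k`. -/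
instance : (forget k).LaxMonoidal where
  ε := ModuleCat.ofHom (X := k) (Y := k) LinearMap.id
  μ X Y := ModuleCat.ofHom (X := X ⊗[k] Y) (Y := (X ⊗ Y : TopFreeVect k))
    (TensorProduct.lift (tpureBilin k))
  μ_natural_left f Z := ModuleCat.hom_ext (TensorProduct.ext' fun u v =>
    (tensorHom_pure f (𝟙 Z) u v).symm)
  μ_natural_right Z f := ModuleCat.hom_ext (TensorProduct.ext' fun u v =>
    (tensorHom_pure (𝟙 Z) f u v).symm)
  associativity X Y Z := ModuleCat.hom_ext (TensorProduct.ext_threefold fun u v w =>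
    associator_pure (X := X) (Y := Y) (Z := Z) u v w)
  left_unitality X := ModuleCat.hom_ext (TensorProduct.ext' fun c u =>
    (leftUnitor_pure (X := X) c u).symm)
  right_unitality X := ModuleCat.hom_ext (TensorProduct.ext' fun u c =>
    (rightUnitor_pure (X := X) c u).symm)

/-- The coherence map `Φ = (Λ ⊗ Λ)^* : V^* ⊛ W^* → (V ⊗ W)^*`. -/
def algMu (V W : (ModuleCat.{u} k)ᵒᵖ) :
    (Alg k).obj V ⊗ (Alg k).obj W ⟶ (Alg k).obj (V ⊗ W) :=
  (Alg k).map (X := op ((Top k).obj (op ((Alg k).obj V)) ⊗ (Top k).obj (op ((Alg k).obj W))))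
    (Y := V ⊗ W)
    (ModuleCat.ofHom (TensorProduct.map (dualEval k V.unop) (dualEval k W.unop))).op

/-- The coherence map `φ : k → k^*`, `φ 1 = id`. -/
def algEps : 𝟙_ (TopFreeVect k) ⟶ (Alg k).obj (𝟙_ (ModuleCat.{u} k)ᵒᵖ) :=
  mk (X := unit k) (Y := algDual k k)
    (unitAlgDual (k := k))

variable {k}

theorem algMu_pure_apply {V W : (ModuleCat.{u} k)ᵒᵖ} (f : Module.Dual k V.unop)
    (g : Module.Dual k W.unop) (v : V.unop) (w : W.unop) :
    (show Module.Dual k (V.unop ⊗[k] W.unop) from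
      app (algMu k V W) (pure (X := (Alg k).obj V) (Y := (Alg k).obj W) f g)) (v ⊗ₜ w) =
      f v * g w := rfl

/-- The algebraic dual functor is monoidal through `Φ` and `φ`. -/
instance : (Alg k).LaxMonoidal where
  ε := algEps k
  μ V W := algMu k V W
  μ_natural_left f Z := tensor_ext fun a b => by
    apply TensorProduct.ext'
    intro v w
    rfl
  μ_natural_right Z f := tensor_ext fun a b => by
    apply TensorProduct.ext'
    intro v w
    rfl
  associativity U V W := tensor_ext₃ fun a b c => by
    simp only [app_comp, ContinuousLinearMap.comp_apply, associator_pure]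
    exact TensorProduct.ext (LinearMap.ext fun u => TensorProduct.ext' fun v w =>
      mul_assoc ((show Module.Dual k U.unop from a) u) ((show Module.Dual k V.unop from b) v)
        ((show Module.Dual k W.unop from c) w))
  left_unitality V := tensor_ext fun (c : k) a => by
    refine (leftUnitor_pure (X := (Alg k).obj V) c a).trans ?_
    simp only [app_comp, ContinuousLinearMap.comp_apply]
    exact LinearMap.ext fun v =>
      congrArg (fun x : k => x * (show Module.Dual k V.unop from a) v) (mul_one c).symm
  right_unitality V := tensor_ext fun a (c : k) => by
    refine (rightUnitor_pure (X := (Alg k).obj V) c a).trans ?_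
    simp only [app_comp, ContinuousLinearMap.comp_apply]
    exact LinearMap.ext fun v => (mul_comm c _).trans
      (congrArg (fun x : k => (show Module.Dual k V.unop from a) v * x) (mul_one c).symm)

variable (k)

/-- The functor `Ã` from monoids in topologically free vector spaces to monoids in vector spaces,
induced by the lax monoidal forgetful functor. -/
def monForget : Mon (TopFreeVect k) ⥤ Mon (ModuleCat.{u} k) := (forget k).mapMon

/-- The functor `O` from monoids in vector spaces to unital algebras. -/
abbrev monToAlg (k : Type u) [Field k] : Mon (ModuleCat.{u} k) ⥤ AlgCat.{u} k :=
  ModuleCat.monModuleEquivalenceAlgebra.functor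

/-- The functor `O⁻¹` from unital algebras to monoids in vector spaces. -/
abbrev algToMon (k : Type u) [Field k] : AlgCat.{u} k ⥤ Mon (ModuleCat.{u} k) :=
  ModuleCat.monModuleEquivalenceAlgebra.inverse

/-- The underlying algebra functor `O ∘ Ã`. -/
def underlyingAlgebra : Mon (TopFreeVect k) ⥤ AlgCat.{u} k := monForget k ⋙ monToAlg k

/-- The algebraic dual monoid functor, induced by the monoidal functor `Alg` on monoids in the
opposite of the category of vector spaces, that is, on the opposite of the category of
coalgebras. -/
def algDualMonoid : (Comon (ModuleCat.{u} k))ᵒᵖ ⥤ Mon (TopFreeVect k) :=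
  (Comon.Comon_EquivMon_OpOp (ModuleCat.{u} k)).functor.leftOp ⋙ (Alg k).mapMon

/-- The finite dual functor `A ↦ A⁰` from algebras to coalgebras. -/
def finiteDualAlg (k : Type u) [Field k] : (AlgCat.{u} k)ᵒᵖ ⥤ CoalgCat.{u} k where
  obj A := CoalgCat.of k (FiniteDual k A.unop)
  map f := CoalgCat.ofHom (FiniteDual.map f.unop.hom)
  map_id _ := rfl
  map_comp _ _ := rfl

/-- The finite dual functor `D_fin` from monoids in vector spaces to coalgebras, that is, comonoids
in vector spaces. -/
def Dfin (k : Type u) [Field k] : (Mon (ModuleCat.{u} k))ᵒᵖ ⥤ Comon (ModuleCat.{u} k) :=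
  (monToAlg k).op ⋙ finiteDualAlg k ⋙ (CoalgCat.comonEquivalence k).functor

/-- The composite of `O⁻¹`, of the opposite of `D_fin`, and of the algebraic dual monoid functor. -/
def finiteDualMonoid : AlgCat.{u} k ⥤ Mon (TopFreeVect k) :=
  algToMon k ⋙ (Dfin k).rightOp ⋙ algDualMonoid k

end TopFreeVect

end Topological

end TopFree

end

/-!
The adjunction `A ↦ (A⁰)^*` ⊣ underlying algebra has as unit the evaluation map
`A → (A⁰)^*`, `a ↦ (f ↦ f a)`.

Its universal property rests on reflexivity: continuous linear forms on `V^*` are evaluations at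
vectors of `V`, and a topologically free `M` is `(M')^*` through `u ↦ (ℓ ↦ ℓ u)`. Hence, for a
monoid `M` and `ℓ ∈ M'`, the continuous form `ℓ ∘ μ` on `M ⊛ M = (M' ⊗ M')^*` is an element `t` of
`M' ⊗ M'` (this makes `M'` a coalgebra). If `φ : A → M` is an algebra map, the form `ℓ ∘ φ`
satisfies `ℓ (φ (a b)) = t (φ a, φ b)`, so that its translates `a ↦ ℓ (φ (a b))` span a
finite-dimensional space and `ℓ ∘ φ` lies in `A⁰` (`mem_finiteDualSubmodule_of_dualDistrib`). The map `ℓ ↦ ℓ ∘ φ`,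
`M' → A⁰`, respects comultiplications (`comul_restrictForms`), so its transpose
`(A⁰)^* → (M')^* ≃ M` is a morphism of monoids that extends `φ` along the evaluation map.

The extension is unique because the evaluations at the elements of `A` span a dense subspace of
`(A⁰)^*`: a continuous form on `(A⁰)^*` is an element of `A⁰`, and it is zero if it vanishes on `A`
(`hom_ext_of_ev`).
-/

noncomputable section

namespace TopFree

/-! ### Representative forms -/

section Representative

variable {k : Type*} [Field k] {A : Type*} [Ring A] [Algebra k A]

/-- A bilinear form that comes from `M^* ⊗ N^*` has finite rank. -/
theorem finite_range_curry_dualDistrib {M N : Type*} [AddCommGroup M] [Module k M]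
    [AddCommGroup N] [Module k N] (t : Module.Dual k M ⊗[k] Module.Dual k N) :
    Module.Finite k
      (LinearMap.range (TensorProduct.curry (TensorProduct.dualDistrib k M N t)).flip) := by
  induction t with
  | zero =>
    have h : (TensorProduct.curry (TensorProduct.dualDistrib k M N 0)).flip = 0 := by
      ext; simp
    rw [h, LinearMap.range_zero]
    infer_instance
  | tmul f g =>
    refine Submodule.finiteDimensional_of_le (S₂ := k ∙ f) ?_
    rintro _ ⟨x, rfl⟩
    exact Submodule.mem_span_singleton.2 ⟨g x, by ext; simp [mul_comm]⟩
  | add s t hs ht =>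
    refine Submodule.finiteDimensional_of_le (S₂ :=
      LinearMap.range (TensorProduct.curry (TensorProduct.dualDistrib k M N s)).flip ⊔
        LinearMap.range (TensorProduct.curry (TensorProduct.dualDistrib k M N t)).flip) ?_
    rintro _ ⟨x, rfl⟩
    refine Submodule.mem_sup.2 ⟨_, ⟨x, rfl⟩, _, ⟨x, rfl⟩, ?_⟩
    ext; simp

/-- A linear form `f` for which `(a, b) ↦ f (a b)` comes from `A^* ⊗ A^*` belongs to `A⁰`. The left
ideal `J` of all `x` with `f (A x) = 0` has finite codimension, since `(a, b) ↦ f (a b)` has finite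
rank, and the annihilator of the `A`-module `A ⧸ J` is a two-sided ideal of finite codimension on
which `f` vanishes. -/
theorem mem_finiteDualSubmodule_of_dualDistrib {f : Module.Dual k A}
    (t : Module.Dual k A ⊗[k] Module.Dual k A)
    (h : ∀ a b, TensorProduct.dualDistrib k A A t (a ⊗ₜ b) = f (a * b)) :
    f ∈ finiteDualSubmodule k A := by
  let p : A →ₗ[k] Module.Dual k A :=
    (TensorProduct.curry (TensorProduct.dualDistrib k A A t)).flip
  have hp : ∀ x y, p x y = f (y * x) := fun x y => h y x
  let J : Ideal A :=
    { carrier := {x | p x = 0}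
      add_mem' := fun {x y} hx hy => by
        change p (x + y) = 0
        rw [map_add, hx, hy, add_zero]
      zero_mem' := map_zero p
      smul_mem' := fun c x hx => by
        change p (c * x) = 0
        ext y
        rw [hp, ← mul_assoc, ← hp, hx]
        rfl }
  have hJ : LinearMap.ker p = J.restrictScalars k := rfl
  have hfin : Module.Finite k (A ⧸ J) := by
    have : Module.Finite k (LinearMap.range p) := finite_range_curry_dualDistrib t
    have := Module.Finite.equiv p.quotKerEquivRange.symm
    rw [hJ] at this
    exact this
  let ρ : A →ₐ[k] Module.End k (A ⧸ J) := Algebra.lsmul k k (A ⧸ J)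
  refine ⟨RingHom.ker ρ, inferInstance, ?_, fun a ha => ?_⟩
  · have hρ : LinearMap.ker ρ.toLinearMap = (RingHom.ker ρ).restrictScalars k := rfl
    have := Module.Finite.equiv ρ.toLinearMap.quotKerEquivRange.symm
    rw [hρ] at this
    exact this
  · have h1 : a • (Submodule.Quotient.mk 1 : A ⧸ J) = 0 :=
      LinearMap.congr_fun (RingHom.mem_ker.1 ha) _
    rw [← Submodule.Quotient.mk_smul, Submodule.Quotient.mk_eq_zero, smul_eq_mul, mul_one] at h1
    have h2 : p a 1 = 0 := LinearMap.congr_fun (show p a = 0 from h1) 1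
    rwa [hp, one_mul] at h2

end Representative

namespace TopFreeVect

/-! ### The monoid dual to the finite dual -/

variable {k : Type u} [Field k] [TopologicalSpace k] [IsTopologicalRing k] [T2Space k]

variable (k) in
/-- The functor `A ↦ (A⁰)^*` formed directly from algebras, without the passage through monoids in
vector spaces. -/
def finiteDualDual : AlgCat.{u} k ⥤ Mon (TopFreeVect k) :=
  (finiteDualAlg k ⋙ (CoalgCat.comonEquivalence k).functor).rightOp ⋙ algDualMonoid k

variable (k) in
/-- `finiteDualMonoid` sends `A` to the value of `finiteDualDual` at `O (O⁻¹ A)`. The algebra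
`O (O⁻¹ A)` is isomorphic, not definitionally equal, to `A`. -/
def finiteDualMonoidIso : finiteDualMonoid k ≅ finiteDualDual k :=
  Functor.isoWhiskerRight (ModuleCat.monModuleEquivalenceAlgebra (R := k)).counitIso
    (finiteDualDual k)

/-- A continuous linear form on `E ⊛ F = (E' ⊗ F')^*` is the evaluation at an element of
`E' ⊗ F'`. -/
theorem exists_dualDistrib_eq {E F : Type*} [AddCommGroup E] [Module k E] [TopologicalSpace E]
    [AddCommGroup F] [Module k F] [TopologicalSpace F] (s : TTensor k E F →L[k] k) :
    ∃ t : (E →L[k] k) ⊗[k] (F →L[k] k), ∀ u v,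
      s (tpure k u v) = TensorProduct.dualDistrib k _ _ (bidualL k E u ⊗ₜ bidualL k F v) t := by
  obtain ⟨t, rfl⟩ := dualEval_surjective s
  exact ⟨t, fun _ _ => rfl⟩

variable (A : AlgCat.{u} k) {M : Mon (TopFreeVect k)}

/-- The convolution product `(x ⊗ y) ∘ Δ` of linear forms on `A⁰`. -/
def convMul (x y : Module.Dual k (FiniteDual k A)) : Module.Dual k (FiniteDual k A) :=
  TensorProduct.dualDistrib k _ _ (x ⊗ₜ y) ∘ₗ FiniteDual.comul k A

/-- The multiplication of the monoid `(A⁰)^*` is the convolution product. -/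
theorem finiteDualDual_mul (x y : Module.Dual k (FiniteDual k A)) :
    app (MonObj.mul (X := ((finiteDualDual k).obj A).X))
      (pure (X := algDual k (FiniteDual k A)) (Y := algDual k (FiniteDual k A)) x y) =
        convMul A x y := by
  have h : (show Module.Dual k (FiniteDual k A ⊗[k] FiniteDual k A) from
      app (algMu k (op (ModuleCat.of k (FiniteDual k A))) (op (ModuleCat.of k (FiniteDual k A))))
        (pure (X := algDual k (FiniteDual k A)) (Y := algDual k (FiniteDual k A)) x y)) =
      TensorProduct.dualDistrib k _ _ (x ⊗ₜ y) := TensorProduct.ext' fun _ _ => rfl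
  exact congrArg (fun z => z ∘ₗ FiniteDual.comul k A) h

/-- The unit of the adjunction: the algebra map `A → (A⁰)^*`, `a ↦ (f ↦ f a)`. -/
def unitHom : A →ₐ[k] (underlyingAlgebra k).obj ((finiteDualDual k).obj A) where
  toFun a := show Module.Dual k (FiniteDual k A) from FiniteDual.ev k A a
  map_zero' := LinearMap.ext fun f => f.1.map_zero
  map_add' a b := LinearMap.ext fun f => f.1.map_add a b
  map_one' := LinearMap.ext fun f => (one_mul (f.1 1)).symm
  map_mul' a b := (LinearMap.ext fun f => (FiniteDual.dualDistrib_comul f a b).symm).trans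
    (finiteDualDual_mul A (FiniteDual.ev k A a) (FiniteDual.ev k A b)).symm
  commutes' c := LinearMap.ext fun f => by
    change f.1 (algebraMap k A c) = c * f.1 1
    rw [Algebra.algebraMap_eq_smul_one, map_smul, smul_eq_mul]

/-! ### Extension of an algebra map to the dual of the finite dual -/

variable {A}

/-- The comultiplication of `M'`: for `ℓ ∈ M'` there is `t ∈ M' ⊗ M'` with
`ℓ (u v) = t (u, v)`. -/
theorem mul_eq_dualDistrib (ℓ : M.X →L[k] k) :
    ∃ t : (M.X →L[k] k) ⊗[k] (M.X →L[k] k), ∀ u v : M.X,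
      ℓ (app (MonObj.mul (X := M.X)) (pure u v)) =
        TensorProduct.dualDistrib k _ _ (bidualL k M.X u ⊗ₜ bidualL k M.X v) t :=
  exists_dualDistrib_eq (k := k) (ℓ.comp (app (MonObj.mul (X := M.X))))

variable (φ : A →ₐ[k] (underlyingAlgebra k).obj M)

/-- The map `ℓ ↦ ℓ ∘ φ` from `M'` to the algebraic dual of `A`. -/
def pullback : (M.X →L[k] k) →ₗ[k] Module.Dual k A where
  toFun ℓ :=
    { toFun := fun a => ℓ (show M.X from φ a)
      map_add' := fun a b => (congrArg ℓ (map_add φ a b)).trans (map_add ℓ _ _)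
      map_smul' := fun c a => (congrArg ℓ (map_smul φ c a)).trans (map_smul ℓ _ _) }
  map_add' _ _ := rfl
  map_smul' _ _ := rfl

theorem pullback_apply (ℓ : M.X →L[k] k) (a : A) : pullback φ ℓ a = ℓ (show M.X from φ a) := rfl

theorem dualDistrib_map_pullback (t : (M.X →L[k] k) ⊗[k] (M.X →L[k] k)) (a b : A) :
    TensorProduct.dualDistrib k A A (TensorProduct.map (pullback φ) (pullback φ) t) (a ⊗ₜ b) =
      TensorProduct.dualDistrib k _ _
        (bidualL k M.X (show M.X from φ a) ⊗ₜ bidualL k M.X (show M.X from φ b)) t := by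
  induction t with
  | zero => simp
  | tmul => rfl
  | add s t hs ht => simp only [map_add, LinearMap.add_apply, hs, ht]

theorem pullback_mem (ℓ : M.X →L[k] k) : pullback φ ℓ ∈ finiteDualSubmodule k A := by
  obtain ⟨t, ht⟩ := mul_eq_dualDistrib (M := M) ℓ
  refine mem_finiteDualSubmodule_of_dualDistrib
    (TensorProduct.map (pullback φ) (pullback φ) t) fun a b => ?_
  rw [dualDistrib_map_pullback, ← ht, pullback_apply, map_mul]
  rfl

/-- The map `M' → A⁰`, `ℓ ↦ ℓ ∘ φ`. -/
def restrictForms : (M.X →L[k] k) →ₗ[k] FiniteDual k A :=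
  LinearMap.codRestrict (finiteDualSubmodule k A) (pullback φ) (pullback_mem φ)

theorem restrictForms_apply (ℓ : M.X →L[k] k) (a : A) :
    (restrictForms φ ℓ).1 a = ℓ (show M.X from φ a) := rfl

/-- The map `M' → A⁰` respects the comultiplications. -/
theorem comul_restrictForms {ℓ : M.X →L[k] k} {t : (M.X →L[k] k) ⊗[k] (M.X →L[k] k)}
    (ht : ∀ u v : M.X, ℓ (app (MonObj.mul (X := M.X)) (pure u v)) =
      TensorProduct.dualDistrib k _ _ (bidualL k M.X u ⊗ₜ bidualL k M.X v) t) :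
    FiniteDual.comul k A (restrictForms φ ℓ) =
      TensorProduct.map (restrictForms φ) (restrictForms φ) t := by
  apply FiniteDual.pairing_injective
  apply TensorProduct.ext'
  intro a b
  have h : FiniteDual.pairing k A (TensorProduct.map (restrictForms φ) (restrictForms φ) t) =
      TensorProduct.dualDistrib k A A (TensorProduct.map (pullback φ) (pullback φ) t) := by
    rw [FiniteDual.pairing, LinearMap.comp_apply, ← LinearMap.comp_apply (TensorProduct.map _ _),
      ← TensorProduct.map_comp]
    rfl
  rw [h, dualDistrib_map_pullback, ← ht, FiniteDual.pairing_comul, LinearMap.comp_apply,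
    LinearMap.mul'_apply, restrictForms_apply, map_mul]
  rfl

/-- The composite `(A⁰)^* → (M')^* ≃ M` of the transpose of `ℓ ↦ ℓ ∘ φ` with the inverse of
`u ↦ (ℓ ↦ ℓ u)`. -/
def extendL : Module.Dual k (FiniteDual k A) →L[k] M.X :=
  ((gamma M.X).symm : Module.Dual k (M.X →L[k] k) →L[k] M.X).comp (transposeL (restrictForms φ))

theorem apply_extendL (ℓ : M.X →L[k] k) (x : Module.Dual k (FiniteDual k A)) :
    ℓ (extendL φ x) = x (restrictForms φ ℓ) :=
  LinearMap.congr_fun ((gamma M.X).apply_symm_apply (transposeL (restrictForms φ) x)) ℓ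

theorem eq_of_forall_form {u v : M.X} (h : ∀ ℓ : M.X →L[k] k, ℓ u = ℓ v) : u = v :=
  bidualL_injective M.X (LinearMap.ext h)

theorem extendL_ev (a : A) : extendL φ (FiniteDual.ev k A a) = φ a :=
  eq_of_forall_form fun ℓ => apply_extendL φ ℓ _

theorem extendL_mul (x y : Module.Dual k (FiniteDual k A)) :
    extendL φ (convMul A x y) =
      app (MonObj.mul (X := M.X)) (pure (extendL φ x) (extendL φ y)) := by
  apply eq_of_forall_form
  intro ℓ
  obtain ⟨t, ht⟩ := mul_eq_dualDistrib (M := M) ℓ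
  rw [apply_extendL, ht, convMul, LinearMap.comp_apply, comul_restrictForms φ ht]
  clear ht
  induction t with
  | zero => simp
  | tmul ℓ₁ ℓ₂ =>
    exact congrArg₂ (· * ·) (apply_extendL φ ℓ₁ x).symm (apply_extendL φ ℓ₂ y).symm
  | add s t hs ht => simp only [map_add, hs, ht]

/-- Compatibility with the units, the unit of `(A⁰)^*` being `c ↦ c • ε`. -/
theorem extendL_one (c : k) :
    extendL φ (c • FiniteDual.counit k A) = app (MonObj.one (X := M.X)) c := by
  have h1 : extendL φ (FiniteDual.counit k A) = app (MonObj.one (X := M.X)) (1 : k) :=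
    (extendL_ev φ 1).trans (map_one φ)
  rw [map_smul, h1]
  exact ((map_smul (app (MonObj.one (X := M.X))) c (1 : k)).symm).trans
    (congrArg (app (MonObj.one (X := M.X))) (mul_one c))

/-- The morphism of monoids `(A⁰)^* ⟶ M` that extends the algebra map `φ : A → M`. -/
def extend : (finiteDualDual k).obj A ⟶ M where
  hom := mk (X := algDual k (FiniteDual k A)) (extendL φ)
  isMonHom_hom :=
    { one_hom := app_injective (ContinuousLinearMap.ext fun c => extendL_one φ c)
      mul_hom := tensor_ext fun x y => by
        refine (congrArg (extendL φ) (finiteDualDual_mul A x y)).trans ?_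
        refine (extendL_mul φ x y).trans ?_
        exact congrArg (app (MonObj.mul (X := M.X))) (tensorHom_pure
          (X₁ := algDual k (FiniteDual k A)) (X₂ := algDual k (FiniteDual k A))
          (mk (X := algDual k (FiniteDual k A)) (extendL φ))
          (mk (X := algDual k (FiniteDual k A)) (extendL φ)) x y).symm }

/-- Two morphisms out of `(A⁰)^*` that agree on the evaluations at the elements of `A` are equal:
the difference of their composites with `ℓ ∈ M'` is the evaluation at an element of `A⁰` that
vanishes on `A`. -/
theorem hom_ext_of_ev {f g : (finiteDualDual k).obj A ⟶ M}
    (h : ∀ a : A, app f.hom (FiniteDual.ev k A a) = app g.hom (FiniteDual.ev k A a)) : f = g := by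
  apply Mon.Hom.ext
  apply app_injective
  apply ContinuousLinearMap.ext
  intro x
  apply eq_of_forall_form
  intro ℓ
  have key : ∀ s : Module.Dual k (FiniteDual k A) →L[k] k,
      (∀ a, s (FiniteDual.ev k A a) = 0) → s = 0 := by
    intro s hs
    obtain ⟨c, rfl⟩ := dualEval_surjective s
    rw [FiniteDual.ev_sep k A c hs, map_zero]
  have h0 := key ((ℓ.comp (app f.hom)) - ℓ.comp (app g.hom)) fun a =>
    sub_eq_zero.2 (congrArg ℓ (h a))
  exact sub_eq_zero.1 (congrArg (fun s : Module.Dual k (FiniteDual k A) →L[k] k => s x) h0)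

/-! ### The adjunction -/

/-- Morphisms of monoids `(A⁰)^* ⟶ M` correspond to algebra maps from `A` to `M`. -/
def homEquiv (A : AlgCat.{u} k) (M : Mon (TopFreeVect k)) :
    ((finiteDualDual k).obj A ⟶ M) ≃ (A ⟶ (underlyingAlgebra k).obj M) where
  toFun f := AlgCat.ofHom (unitHom A) ≫ (underlyingAlgebra k).map f
  invFun φ := extend φ.hom
  left_inv f := hom_ext_of_ev fun a => extendL_ev _ a
  right_inv φ := AlgCat.Hom.ext (AlgHom.ext fun a => extendL_ev φ.hom a)

variable (k) in
/-- The functor `A ↦ (A⁰)^*` is left adjoint to the underlying algebra functor. -/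
def adjunction : finiteDualDual k ⊣ underlyingAlgebra k :=
  Adjunction.mkOfHomEquiv
    { homEquiv := homEquiv
      homEquiv_naturality_left_symm := fun {A B M} φ ψ => hom_ext_of_ev fun a =>
        (extendL_ev (φ ≫ ψ).hom a).trans (extendL_ev ψ.hom (φ.hom a)).symm
      homEquiv_naturality_right := fun {A M N} f g => by
        change _ ≫ (underlyingAlgebra k).map (f ≫ g) = (_ ≫ _) ≫ _
        rw [Functor.map_comp, Category.assoc] }

end TopFreeVect

end TopFree

end

theorem mainTheorem6 (k : Type u) [Field k] [TopologicalSpace k] [IsTopologicalRing k]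
    [T2Space k] :
    (TopFree.TopFreeVect.underlyingAlgebra k).IsRightAdjoint ∧
      Nonempty (TopFree.TopFreeVect.finiteDualMonoid k ⊣
        TopFree.TopFreeVect.underlyingAlgebra k) := by
  have adj := (TopFree.TopFreeVect.adjunction k).ofNatIsoLeft
    (TopFree.TopFreeVect.finiteDualMonoidIso k).symm
  exact ⟨adj.isRightAdjoint, ⟨adj⟩⟩
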